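/- Let $K\ge 3$ and let $\mathbb T_K$ be the homogeneous tree of degree $K$ (the tree in which every vertex has exactly $K$ neighbours). Let $S^\infty$ be the doubly infinite stack of copies of $\mathbb T_K$: its vertex set is $\mathbb T_K\times\mathbb Z$, and $(u,i)$, $(v,j)$ are adjacent iff either $i=j$ and $u,v$ are adjacent in $\mathbb T_K$, or $u=v$ and $|i-j|=1$. Consider the following continuous-time process $(\sigma_x(t))_{x\in S^\infty,\,t\ge 0}$ with values in $\{+1,-1\}$. The initial spins $\sigma_x(0)$ are independent, equal to $+1$ with probability $\theta$ and to $-1$ with probability $1-\theta$. Each vertex carries a rate $1$ Poisson clock, and each ring of each clock carries a fair $\pm1$ coin toss; all clocks, coin tosses and initial spins are independent. The spin of a vertex changes only when its clock rings; at a ring it takes the spin of the majority of its neighbours immediately before the ring, and the value of the coin toss attached to that ring if there is a tie. Then for every $K\ge 3$ there is $\theta_*<1$, depending only on $K$, such that for all $\theta\in(\theta_*,1]\cap[0,1]$ such a process exists, and every such process fixates to consensus of $+1$: for every vertex $x\in S^\infty$, almost surely there is a finite (random) time $t_0$ with $\sigma_x(t)=+1$ for all $t\ge t_0$. -/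

import Mathlib

open MeasureTheory ProbabilityTheory Filter Topology
open scoped NNReal

namespace MajorityDynamics

/-- The doubly infinite stack of copies of a graph `T`: the vertex set is `V × ℤ`, and `x`, `y` are
joined iff they lie in the same layer and their tree coordinates are adjacent in `T`, or they have
the same tree coordinate and lie in consecutive layers. -/
def stack {V : Type*} (T : SimpleGraph V) : SimpleGraph (V × ℤ) where
  Adj x y := (x.2 = y.2 ∧ T.Adj x.1 y.1) ∨ (x.1 = y.1 ∧ (y.2 = x.2 + 1 ∨ y.2 = x.2 - 1))
  symm := ⟨by
    rintro x y (⟨h₁, h₂⟩ | ⟨h₁, h₂⟩)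
    · exact Or.inl ⟨h₁.symm, h₂.symm⟩
    · exact Or.inr ⟨h₁.symm, by omega⟩⟩
  loopless := ⟨by
    rintro x (⟨-, h⟩ | ⟨-, h⟩)
    · exact T.irrefl h
    · omega⟩

/-- A spin: `true` stands for `+1` and `false` for `-1`. -/
abbrev Spin := Bool

/-- A realization of the initial configuration and of the dynamics on a vertex set `W`:
the initial spins, the waiting times between successive clock rings, and the coin tosses
(indexed by the vertex and the number of the ring, starting from `0`). -/
abbrev Sample (W : Type*) := (W → Spin) × (W × ℕ → ℝ) × (W × ℕ → Spin)

section Sample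

variable {W : Type*}

/-- The initial spin of `x`. -/
def initial (ω : Sample W) (x : W) : Spin := ω.1 x

/-- The time of the ring number `n` (`n = 0, 1, 2, …`) of the clock of `x`. -/
def ringTime (ω : Sample W) (x : W) (n : ℕ) : ℝ := ∑ k ∈ Finset.range (n + 1), ω.2.1 (x, k)

/-- The coin toss attached to the ring number `n` of the clock of `x`. -/
def coin (ω : Sample W) (x : W) (n : ℕ) : Spin := ω.2.2 (x, n)

end Sample

/-- The fair probability `1/2`. -/
noncomputable def fair : unitInterval := ⟨1 / 2, by norm_num, by norm_num⟩

/-- The law of the dynamics: the clocks are independent rate `1` Poisson processes (independent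
waiting times, exponential with parameter `1`), the tosses are independent fair coins, and the two
families are independent. -/
noncomputable def dynLaw (W : Type*) : Measure ((W × ℕ → ℝ) × (W × ℕ → Spin)) :=
  (Measure.infinitePi fun _ : W × ℕ => expMeasure 1).prod
    (Measure.infinitePi fun _ : W × ℕ => bernoulliMeasure true false fair)

/-- The joint law of the initial configuration, a Bernoulli product measure with density `θ`
of `+1` spins, and of the dynamics, which is independent of it. -/
noncomputable def law (W : Type*) (θ : unitInterval) : Measure (Sample W) :=
  (Measure.infinitePi fun _ : W => bernoulliMeasure true false θ).prod (dynLaw W)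

instance instIsProbabilityMeasureDynLaw (W : Type*) : IsProbabilityMeasure (dynLaw W) := by
  have : IsProbabilityMeasure (expMeasure 1) := isProbabilityMeasure_expMeasure one_pos
  unfold dynLaw
  infer_instance

instance instIsProbabilityMeasureLaw (W : Type*) (θ : unitInterval) :
    IsProbabilityMeasure (law W θ) := by
  unfold law
  infer_instance

/-- The number of neighbours of `x` that have spin `s` in the configuration `η`. -/
noncomputable def neighborCount {W : Type*} (G : SimpleGraph W) (η : W → Spin) (x : W) (s : Spin) :
    ℕ :=
  {y | G.Adj x y ∧ η y = s}.ncard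

/-- The new spin of `x` when its clock rings: the majority of the spins of its neighbours in the
configuration `η`, or the coin toss `c` in the event of a tie. -/
noncomputable def majority {W : Type*} (G : SimpleGraph W) (η : W → Spin) (x : W) (c : Spin) :
    Spin :=
  if neighborCount G η x false < neighborCount G η x true then true
  else if neighborCount G η x true < neighborCount G η x false then false
  else c

/-- The evolution `σ` (`σ t x` is the spin of `x` at time `t`) follows the majority dynamics on `G`
driven by the realization `ω`: it starts from the initial configuration, the spin of a vertex does
not change in a time interval in which its clock does not ring, and when the clock rings at time
`t`, the new spin is determined by the spins of the neighbours immediately before `t`. -/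
structure Follows {W : Type*} (G : SimpleGraph W) (ω : Sample W) (σ : ℝ≥0 → W → Spin) : Prop where
  start : ∀ x, σ 0 x = initial ω x
  stay : ∀ x (s t : ℝ≥0), s ≤ t → (∀ n, ringTime ω x n ∉ Set.Ioc (s : ℝ) t) → σ t x = σ s x
  update : ∀ x n (t : ℝ≥0), ringTime ω x n = t →
    ∀ᶠ s in 𝓝[<] t, σ t x = majority G (σ s) x (coin ω x n)

/-- `σ` is a version of the zero-temperature majority dynamics on `G` with initial density `θ`:
almost surely its path follows the dynamics. -/
def IsProcess {W : Type*} (G : SimpleGraph W) (θ : unitInterval)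
    (σ : Sample W → ℝ≥0 → W → Spin) : Prop :=
  ∀ᵐ ω ∂law W θ, Follows G ω (σ ω)

/-- Fixation to `+1` consensus: each vertex, almost surely, has spin `+1` from some finite
(random) time on. -/
def FixatesToConsensus {W : Type*} (θ : unitInterval) (σ : Sample W → ℝ≥0 → W → Spin) : Prop :=
  ∀ x, ∀ᵐ ω ∂law W θ, ∃ t₀ : ℝ≥0, ∀ t, t₀ ≤ t → σ ω t x = true

end MajorityDynamics

open MajorityDynamics

/-! Call a vertex dead if it lies in the closure of the initially negative vertices under
threshold-3 bootstrap percolation (`Dead`). A live vertex has at most two dead neighbours and at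
least K + 2 ≥ 5 neighbours in all, so as long as the live vertices are positive each of them sees a
strict positive majority: live vertices stay positive forever (`Follows.eq_true_of_stable`).

The stack has an acyclic orientation in which each vertex has two parents: its tree parent, and its
copy one layer below. A finite set F thus has at most 2|F| internal edges. If F is infected from
within, each vertex of F that is not initially negative uses three edges of its own, so at least a
third of F is initially negative (`Spanned.exists_bad_subset`). A Peierls count
(`ae_exists_animal_card_lt`) then makes all dead clusters finite when θ is close to 1.

A finite dead cluster erodes from the top: its highest vertex has at most two neighbours in the
cluster, its parents, so it is eventually positive and can be removed
(`Follows.eventually_eq_true_of_finite`).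

Existence rests on the same Peierls estimate: in a short time slab the vertices that ring form
finite clusters, so each spin depends on a well-founded history (`ae_regularClocks`,
`exists_follows`). -/

namespace MajorityDynamics

/-! ### Finite connected sets and their encoding by words. -/

section Animals

variable {W : Type*} [DecidableEq W]

/-- The finite connected vertex sets containing `x`, grown from `x` one adjacent vertex at a
time. -/
inductive IsAnimal (G : SimpleGraph W) (x : W) : Finset W → Prop
  | single : IsAnimal G x {x}
  | grow {C : Finset W} {u v : W} : IsAnimal G x C → u ∈ C → G.Adj u v → IsAnimal G x (insert v C)

namespace IsAnimal

variable {G : SimpleGraph W} {x y : W} {C C' : Finset W}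

theorem root_mem (h : IsAnimal G x C) : x ∈ C := by
  induction h with
  | single => simp
  | grow _ _ _ ih => exact Finset.mem_insert_of_mem ih

theorem union (h : IsAnimal G x C) (h' : IsAnimal G y C') (hy : y ∈ C ∨ ∃ u ∈ C, G.Adj u y) :
    IsAnimal G x (C ∪ C') := by
  induction h' with
  | single =>
    have e : C ∪ {y} = insert y C := by rw [Finset.union_comm]; rfl
    rw [e]
    rcases hy with hy | ⟨u, hu, huy⟩
    · rwa [Finset.insert_eq_of_mem hy]
    · exact h.grow hu huy
  | grow _ hu huv ih =>
    rw [Finset.union_insert]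
    exact ih.grow (Finset.mem_union_right _ hu) huv

/-- A closed walk around a spanning tree: each new vertex `v` is visited by an excursion `u, v, u`,
which costs two steps. -/
theorem exists_walk (h : IsAnimal G x C) :
    ∃ p : G.Walk x x, p.length = 2 * (C.card - 1) ∧ p.support.toFinset = C := by
  induction h with
  | single => exact ⟨.nil, by simp⟩
  | @grow C u v h hu huv ih =>
    obtain ⟨p, hl, hs⟩ := ih
    by_cases hv : v ∈ C
    · exact ⟨p, by rw [Finset.insert_eq_of_mem hv]; exact ⟨hl, hs⟩⟩
    have hup : u ∈ p.support := by rw [← hs] at hu; simpa using hu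
    refine ⟨(p.takeUntil u hup).append (.cons huv (.cons huv.symm (p.dropUntil u hup))), ?_, ?_⟩
    · have h1 := congrArg SimpleGraph.Walk.length (p.take_spec hup)
      have h2 : 0 < C.card := Finset.card_pos.2 ⟨u, hu⟩
      simp only [SimpleGraph.Walk.length_append, SimpleGraph.Walk.length_cons] at h1 ⊢
      rw [Finset.card_insert_of_notMem hv]
      omega
    · ext w
      have h1 : w ∈ p.support ↔ w ∈ C := by rw [← hs]; simp
      rw [← p.take_spec hup, SimpleGraph.Walk.mem_support_append_iff] at h1
      have h2 : u ∈ (p.dropUntil u hup).support := SimpleGraph.Walk.start_mem_support _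
      simp only [List.mem_toFinset, SimpleGraph.Walk.mem_support_append_iff,
        SimpleGraph.Walk.support_cons, List.mem_cons, Finset.mem_insert, ← h1]
      constructor
      · rintro (h | rfl | rfl | h) <;> tauto
      · rintro (rfl | h | h) <;> tauto

end IsAnimal

/-- The vertices visited when following a list of neighbour labels. -/
def trace {D : ℕ} (e : W → Fin D → W) : List (Fin D) → W → Finset W
  | [], x => {x}
  | k :: l, x => insert x (trace e l (e x k))

theorem exists_trace_eq_support {D : ℕ} {e : W → Fin D → W} {G : SimpleGraph W}
    (he : ∀ x y, G.Adj x y → ∃ k, e x k = y) {x y : W} (p : G.Walk x y) :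
    ∃ l : List (Fin D), l.length = p.length ∧ trace e l x = p.support.toFinset := by
  induction p with
  | nil => exact ⟨[], by simp [trace]⟩
  | @cons u v w h p ih =>
    obtain ⟨l, hl, ht⟩ := ih
    obtain ⟨k, hk⟩ := he _ _ h
    exact ⟨k :: l, by simp [hl], by simp [trace, hk, ht]⟩

/-- This bounds the number of animals of size `N` at `x` by `D ^ (2 * (N - 1))`, the entropy term of
the Peierls argument. -/
theorem IsAnimal.exists_trace_eq {D : ℕ} {e : W → Fin D → W} {G : SimpleGraph W}
    (he : ∀ x y, G.Adj x y → ∃ k, e x k = y) {x : W} {C : Finset W} (h : IsAnimal G x C) :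
    ∃ l : List.Vector (Fin D) (2 * (C.card - 1)), trace e l.1 x = C := by
  obtain ⟨p, hl, hs⟩ := h.exists_walk
  obtain ⟨l, hl', ht⟩ := exists_trace_eq_support he p
  exact ⟨⟨l, hl'.trans hl⟩, ht.trans hs⟩

theorem countable_of_labels {D : ℕ} {e : W → Fin D → W} {G : SimpleGraph W} (hG : G.Connected)
    (he : ∀ x y, G.Adj x y → ∃ k, e x k = y) : Countable W := by
  obtain ⟨x⟩ := hG.nonempty
  have hc : (⋃ l : List (Fin D), (trace e l x : Set W)).Countable :=
    Set.countable_iUnion fun l => (trace e l x).countable_toSet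
  refine Set.countable_univ_iff.1 (hc.mono fun y _ => ?_)
  obtain ⟨p⟩ := hG.preconnected x y
  obtain ⟨l, -, ht⟩ := exists_trace_eq_support he p
  exact Set.mem_iUnion.2 ⟨l, by simp [ht]⟩

end Animals

/-! ### Bootstrap percolation with threshold 3. -/

section Bootstrap

variable {W : Type*} {G : SimpleGraph W} {bad : Set W}

/-- The bootstrap closure of `bad` with threshold `3`. -/
inductive Dead (G : SimpleGraph W) (bad : Set W) : W → Prop
  | of_bad {x : W} : x ∈ bad → Dead G bad x
  | of_three {x : W} (s : Finset W) : 3 ≤ s.card → (∀ y ∈ s, G.Adj x y) →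
      (∀ y ∈ s, Dead G bad y) → Dead G bad x

variable [DecidableEq W]

/-- The finite sets all of whose vertices are infected by the bootstrap dynamics restricted to the
set. -/
inductive Spanned (G : SimpleGraph W) (bad : Set W) : Finset W → Prop
  | empty : Spanned G bad ∅
  | insert_bad {F : Finset W} {v : W} : Spanned G bad F → v ∈ bad → Spanned G bad (insert v F)
  | insert_three {F : Finset W} {v : W} (s : Finset W) : Spanned G bad F → s ⊆ F →
      (∀ y ∈ s, G.Adj v y) → 3 ≤ s.card → Spanned G bad (insert v F)

theorem Spanned.union {F F' : Finset W} (h : Spanned G bad F) (h' : Spanned G bad F') :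
    Spanned G bad (F ∪ F') := by
  induction h' with
  | empty => simpa using h
  | insert_bad _ hv ih => rw [Finset.union_insert]; exact ih.insert_bad hv
  | insert_three s _ hs ha hc ih =>
    rw [Finset.union_insert]
    exact ih.insert_three s (hs.trans Finset.subset_union_right) ha hc

/-- An infection has a finite history: the histories of the three or more infecting neighbours are
joined through `x`. -/
theorem Dead.exists_spanned {x : W} (h : Dead G bad x) :
    ∃ F, IsAnimal G x F ∧ Spanned G bad F := by
  induction h with
  | of_bad hx => exact ⟨{_}, .single, Spanned.empty.insert_bad hx⟩
  | @of_three x s hs ha _ ih =>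
    have key : ∀ s' ⊆ s, ∃ U, s' ⊆ U ∧ Spanned G bad U ∧ IsAnimal G x (insert x U) := by
      intro s'
      induction s' using Finset.induction_on with
      | empty => exact fun _ => ⟨∅, by simp, .empty, .single⟩
      | insert y t _ iht =>
        intro hyt
        obtain ⟨U, htU, hU, hxU⟩ := iht fun z hz => hyt (Finset.mem_insert_of_mem hz)
        have hy : y ∈ s := hyt (Finset.mem_insert_self _ _)
        obtain ⟨F, hF, hF'⟩ := ih y hy
        refine ⟨U ∪ F, ?_, hU.union hF', ?_⟩
        · refine Finset.insert_subset (Finset.mem_union_right _ hF.root_mem) ?_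
          exact htU.trans Finset.subset_union_left
        · rw [← Finset.insert_union]
          exact hxU.union hF (.inr ⟨x, Finset.mem_insert_self _ _, ha y hy⟩)
    obtain ⟨U, hsU, hU, hxU⟩ := key s subset_rfl
    exact ⟨_, hxU, hU.insert_three s hsU ha hs⟩

theorem IsAnimal.exists_spanned_superset {x : W} {C : Finset W} (h : IsAnimal G x C)
    (hC : ∀ y ∈ C, Dead G bad y) : ∃ F, C ⊆ F ∧ IsAnimal G x F ∧ Spanned G bad F := by
  induction h with
  | single =>
    obtain ⟨F, hF, hF'⟩ := (hC x (by simp)).exists_spanned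
    exact ⟨F, by simpa using hF.root_mem, hF, hF'⟩
  | @grow C u v _ hu huv ih =>
    obtain ⟨F, hCF, hF, hF'⟩ := ih fun y hy => hC y (Finset.mem_insert_of_mem hy)
    obtain ⟨F₁, h₁, h₁'⟩ := (hC v (Finset.mem_insert_self _ _)).exists_spanned
    refine ⟨F ∪ F₁, ?_, hF.union h₁ (.inr ⟨u, hCF hu, huv⟩), hF'.union h₁'⟩
    exact Finset.insert_subset (Finset.mem_union_right _ h₁.root_mem)
      (hCF.trans Finset.subset_union_left)

/-- If every edge joins a vertex to one of its two parents, a spanned set contains at least one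
third of bad vertices, because it has at most twice as many edges as vertices. -/
theorem Spanned.exists_bad_subset {p : Bool → W → W}
    (hp : ∀ x y, G.Adj x y → ∃ k, p k x = y ∨ p k y = x)
    {F : Finset W} (h : Spanned G bad F) :
    ∃ R ⊆ F, (∀ v ∈ R, v ∈ bad) ∧ F.card ≤ 3 * R.card := by
  -- The filtered set counts pairs (vertex, parent index) whose parent is again in `F`, a proxy for
  -- the internal edges. It has at most `2 * F.card` elements and gains at least three with each
  -- vertex infected by neighbours.
  suffices ∃ R ⊆ F, (∀ v ∈ R, v ∈ bad) ∧
      3 * F.card ≤ 3 * R.card + ((F ×ˢ (Finset.univ : Finset Bool)).filter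
        fun a => p a.2 a.1 ∈ F).card by
    obtain ⟨R, hR, hb, hc⟩ := this
    refine ⟨R, hR, hb, ?_⟩
    have := Finset.card_filter_le (F ×ˢ (Finset.univ : Finset Bool)) fun a => p a.2 a.1 ∈ F
    rw [Finset.card_product] at this
    simp only [Finset.card_univ, Fintype.card_bool] at this
    omega
  induction h with
  | empty => exact ⟨∅, by simp⟩
  | @insert_bad F v _ hv ih =>
    obtain ⟨R, hR, hb, hc⟩ := ih
    by_cases hvF : v ∈ F
    · rw [Finset.insert_eq_of_mem hvF]; exact ⟨R, hR, hb, hc⟩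
    refine ⟨insert v R, Finset.insert_subset_insert _ hR, ?_, ?_⟩
    · simpa using ⟨hv, hb⟩
    · rw [Finset.card_insert_of_notMem hvF, Finset.card_insert_of_notMem fun h => hvF (hR h)]
      have : ((F ×ˢ (Finset.univ : Finset Bool)).filter fun a => p a.2 a.1 ∈ F).card ≤
          (((insert v F) ×ˢ (Finset.univ : Finset Bool)).filter
            fun a => p a.2 a.1 ∈ insert v F).card := by
        refine Finset.card_le_card fun a ha => ?_
        simp only [Finset.mem_filter, Finset.mem_product, Finset.mem_insert] at ha ⊢
        tauto
      omega
  | @insert_three F v s _ hs ha hs3 ih =>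
    obtain ⟨R, hR, hb, hc⟩ := ih
    by_cases hvF : v ∈ F
    · rw [Finset.insert_eq_of_mem hvF]; exact ⟨R, hR, hb, hc⟩
    refine ⟨R, hR.trans (Finset.subset_insert _ _), hb, ?_⟩
    rw [Finset.card_insert_of_notMem hvF]
    have hnew : ∀ y ∈ s, ∃ k, p k v = y ∨ p k y = v := fun y hy => hp v y (ha y hy)
    choose! k hk using hnew
    -- The edge from `v` to `y` is recorded at its child endpoint. Such a pair is new because it
    -- involves `v`, which is not in `F`.
    let g : W → W × Bool := fun y => if p (k y) v = y then (v, k y) else (y, k y)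
    have hsv : ∀ y ∈ s, y ≠ v := fun y hy h => hvF (h ▸ hs hy)
    have hg : Set.InjOn g s := by
      intro y hy z hz hyz
      simp only [g] at hyz
      split_ifs at hyz with h1 h2 h2
      · rw [Prod.mk.injEq] at hyz
        rw [← h1, ← h2, hyz.2]
      · exact absurd (congrArg Prod.fst hyz).symm (hsv z hz)
      · exact absurd (congrArg Prod.fst hyz) (hsv y hy)
      · exact congrArg Prod.fst hyz
    have hdisj : Disjoint ((F ×ˢ (Finset.univ : Finset Bool)).filter fun a => p a.2 a.1 ∈ F)
        (s.image g) := by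
      rw [Finset.disjoint_left]
      intro a ha' hag
      obtain ⟨y, hy, rfl⟩ := Finset.mem_image.1 hag
      simp only [Finset.mem_filter, Finset.mem_product, g] at ha'
      split_ifs at ha' with h1
      · exact hvF ha'.1.1
      · rw [(hk y hy).resolve_left h1] at ha'
        exact hvF ha'.2
    have hsub : ((F ×ˢ (Finset.univ : Finset Bool)).filter fun a => p a.2 a.1 ∈ F) ∪ s.image g ⊆
        (((insert v F) ×ˢ (Finset.univ : Finset Bool)).filter
            fun a => p a.2 a.1 ∈ insert v F) := by
      refine Finset.union_subset (fun a ha' => ?_) fun a hag => ?_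
      · simp only [Finset.mem_filter, Finset.mem_product, Finset.mem_insert] at ha' ⊢
        tauto
      · obtain ⟨y, hy, rfl⟩ := Finset.mem_image.1 hag
        simp only [Finset.mem_filter, Finset.mem_product, Finset.mem_insert, g]
        split_ifs with h1
        · simp [h1, hs hy]
        · simp [(hk y hy).resolve_left h1, hs hy]
    have := Finset.card_le_card hsub
    rw [Finset.card_union_of_disjoint hdisj, Finset.card_image_of_injOn hg] at this
    omega

end Bootstrap

end MajorityDynamics

namespace MajorityDynamics

/-! ### The Peierls estimate. -/

section Peierls

open scoped ENNReal

variable {W : Type*} [DecidableEq W] {G : SimpleGraph W}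

/-- Peierls estimate: if the probability that all vertices of a finite set are marked decays fast
enough with the size of the set, then almost surely large animals containing a given vertex have
less than one third of marked vertices. -/
theorem ae_exists_animal_card_lt {Ω : Type*} [MeasurableSpace Ω] {μ : Measure Ω} {E : W → Set Ω}
    {D : ℕ} {e : W → Fin D → W} (he : ∀ x y, G.Adj x y → ∃ k, e x k = y) (hD : 0 < D)
    {r : ℝ≥0∞} (hr : 2 * (D : ℝ≥0∞) ^ 2 * r ≤ 2⁻¹)
    (hE : ∀ R : Finset W, μ (⋂ v ∈ R, E v) ≤ (r ^ 3) ^ R.card) (x : W) :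
    ∀ᵐ ω ∂μ, ∃ n, ∀ C R : Finset W, IsAnimal G x C → R ⊆ C → (∀ v ∈ R, ω ∈ E v) →
      C.card ≤ 3 * R.card → C.card < n := by
  have hD1 : (1 : ℝ≥0∞) ≤ D := by exact_mod_cast hD
  have hr1 : r ≤ 1 := by
    have h1 : (1 : ℝ≥0∞) ≤ 2 * (D : ℝ≥0∞) ^ 2 :=
      one_le_mul (by norm_num) (one_le_pow₀ hD1)
    calc r = 1 * r := (one_mul r).symm
      _ ≤ 2 * (D : ℝ≥0∞) ^ 2 * r := by gcongr
      _ ≤ 2⁻¹ := hr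
      _ ≤ 1 := by simp
  -- A word of length `2 * (N - 1)` need not visit exactly `N` vertices; words that do not
  -- contribute nothing. For the others `N ≤ 3 * R.card` turns `(r ^ 3) ^ R.card` into at most `r ^
  -- N`.
  let Q : ℕ → Finset W → Finset (Finset W) := fun N C =>
    if C.card = N then C.powerset.filter fun R => N ≤ 3 * R.card else ∅
  let B : ℕ → Set Ω := fun N => ⋃ l : List.Vector (Fin D) (2 * (N - 1)),
    ⋃ R ∈ Q N (trace e l.1 x), ⋂ v ∈ R, E v
  have hQ : ∀ N C, (∑ R ∈ Q N C, (r ^ 3) ^ R.card) ≤ 2 ^ N * r ^ N := by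
    intro N C
    simp only [Q]
    split_ifs with h
    · calc _ ≤ ∑ R ∈ C.powerset.filter (fun R => N ≤ 3 * R.card), r ^ N := by
            refine Finset.sum_le_sum fun R hR => ?_
            rw [← pow_mul]
            exact pow_le_pow_of_le_one zero_le hr1 (Finset.mem_filter.1 hR).2
        _ ≤ ∑ R ∈ C.powerset, r ^ N :=
            Finset.sum_le_sum_of_subset (Finset.filter_subset _ _)
        _ = 2 ^ N * r ^ N := by
            rw [Finset.sum_const, Finset.card_powerset, h, nsmul_eq_mul]; push_cast; rfl
    · simp
  have hB : ∀ N, μ (B N) ≤ 2⁻¹ ^ N := by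
    intro N
    calc μ (B N) ≤ ∑ l : List.Vector (Fin D) (2 * (N - 1)),
          μ (⋃ R ∈ Q N (trace e l.1 x), ⋂ v ∈ R, E v) := measure_iUnion_fintype_le _ _
      _ ≤ ∑ l : List.Vector (Fin D) (2 * (N - 1)), 2 ^ N * r ^ N := by
          refine Finset.sum_le_sum fun l _ => ?_
          exact (measure_biUnion_finset_le _ _).trans
            ((Finset.sum_le_sum fun R _ => hE R).trans (hQ N _))
      _ = (D : ℝ≥0∞) ^ (2 * (N - 1)) * (2 ^ N * r ^ N) := by
          rw [Finset.sum_const, Finset.card_univ, card_vector, Fintype.card_fin, nsmul_eq_mul]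
          push_cast; rfl
      _ ≤ (D : ℝ≥0∞) ^ (2 * N) * (2 ^ N * r ^ N) := by
          gcongr ?_ * _
          exact pow_le_pow_right₀ hD1 (by omega)
      _ = (2 * (D : ℝ≥0∞) ^ 2 * r) ^ N := by rw [mul_pow, mul_pow, ← pow_mul]; ring
      _ ≤ 2⁻¹ ^ N := by gcongr
  -- Borel–Cantelli: almost surely only finitely many of the events `B N` occur.
  have hsum : ∑' N, μ (B N) ≠ ∞ := by
    refine ne_top_of_le_ne_top ?_ (ENNReal.tsum_le_tsum hB)
    rw [ENNReal.tsum_geometric]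
    simp
  filter_upwards [ae_eventually_notMem hsum] with ω hω
  obtain ⟨n, hn⟩ := eventually_atTop.1 hω
  refine ⟨n, fun C R hC hRC hR hCR => ?_⟩
  by_contra! hlt
  obtain ⟨l, hl⟩ := hC.exists_trace_eq he
  refine hn C.card hlt (Set.mem_iUnion.2 ⟨l, Set.mem_iUnion₂.2 ⟨R, ?_, by simpa using hR⟩⟩)
  simp only [Q, hl, if_true, Finset.mem_filter, Finset.mem_powerset]
  exact ⟨hRC, hCR⟩

end Peierls

end MajorityDynamics

namespace MajorityDynamics

/-! ### One Poisson clock. -/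

section Clocks

open scoped ENNReal

instance instIsProbabilityMeasureExpMeasureOne : IsProbabilityMeasure (expMeasure 1) :=
  isProbabilityMeasure_expMeasure one_pos

theorem expMeasure_one_le_volume : expMeasure 1 ≤ volume := by
  rw [expMeasure, gammaMeasure]
  conv_rhs => rw [← withDensity_one (μ := (volume : Measure ℝ))]
  refine withDensity_mono (Eventually.of_forall fun x => ?_)
  change exponentialPDF 1 x ≤ 1
  rw [exponentialPDF_eq]
  refine ENNReal.ofReal_le_one.2 ?_
  split_ifs with h
  · simpa using h
  · exact zero_le_one

theorem expMeasure_one_real_Iic {x : ℝ} (hx : 0 ≤ x) :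
    (expMeasure 1).real (Set.Iic x) = 1 - Real.exp (-x) := by
  rw [← cdf_eq_real, cdf_expMeasure_eq one_pos, if_pos hx, one_mul]

theorem expMeasure_one_Iic_zero : expMeasure 1 (Set.Iic 0) = 0 := by
  have h := expMeasure_one_real_Iic le_rfl
  simpa [measureReal_def, ENNReal.toReal_eq_zero_iff] using h

theorem expMeasure_one_Iic_lt_one (x : ℝ) : expMeasure 1 (Set.Iic x) < 1 := by
  refine (measure_mono (Set.Iic_subset_Iic.2 (le_max_left x 0))).trans_lt ?_
  have h := expMeasure_one_real_Iic (le_max_right x 0)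
  rw [← ENNReal.toReal_lt_toReal (measure_ne_top _ _) ENNReal.one_ne_top, ← measureReal_def, h]
  simp [Real.exp_pos]

/-- The law of the waiting times of one clock. -/
noncomputable def waitingLaw : Measure (ℕ → ℝ) := Measure.infinitePi fun _ => expMeasure 1

instance instIsProbabilityMeasureWaitingLaw : IsProbabilityMeasure waitingLaw := by
  unfold waitingLaw; infer_instance

theorem waitingLaw_forall_le (M : ℕ) (T : ℝ) :
    waitingLaw {w | ∀ k < M, w k ≤ T} = expMeasure 1 (Set.Iic T) ^ M := by
  have h := Measure.infinitePi_pi (fun _ : ℕ => expMeasure 1) (s := Finset.range M)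
    (t := fun _ => Set.Iic T) fun _ _ => measurableSet_Iic
  rw [Finset.prod_const, Finset.card_range] at h
  rw [waitingLaw, ← h]
  congr 1
  ext w
  simp [Set.mem_pi]

theorem ae_waitingLaw_pos : ∀ᵐ w ∂waitingLaw, ∀ k, 0 < w k := by
  refine ae_all_iff.2 fun k => ?_
  have h : ∀ᵐ s ∂(expMeasure 1), 0 < s := by
    rw [ae_iff]
    simpa [Set.Iic] using expMeasure_one_Iic_zero
  exact (measurePreserving_eval_infinitePi (fun _ : ℕ => expMeasure 1)
    k).quasiMeasurePreserving.ae h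

theorem ae_waitingLaw_exists_lt_sum (T : ℝ) :
    ∀ᵐ w ∂waitingLaw, ∃ n, T < ∑ k ∈ Finset.range (n + 1), w k := by
  have h0 : waitingLaw {w | ∀ k, w k ≤ T} = 0 := by
    have hc : Tendsto (fun M : ℕ => expMeasure 1 (Set.Iic T) ^ M) atTop (𝓝 0) :=
      ENNReal.tendsto_pow_atTop_nhds_zero_of_lt_one (expMeasure_one_Iic_lt_one T)
    refine le_antisymm (ge_of_tendsto' hc fun M => ?_) zero_le
    rw [← waitingLaw_forall_le]
    exact measure_mono fun w hw k _ => hw k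
  have h1 : ∀ᵐ w ∂waitingLaw, ¬ ∀ k, w k ≤ T := by
    rw [ae_iff]; simpa using h0
  filter_upwards [h1, ae_waitingLaw_pos] with w hw hpos
  push Not at hw
  obtain ⟨n, hn⟩ := hw
  exact ⟨n, hn.trans_le (Finset.single_le_sum (fun k _ => (hpos k).le) (by simp))⟩

/-- The last waiting time is independent of the preceding sum and has density at most 1, so
conditioning on that sum and translating `I` gives the bound. -/
theorem waitingLaw_sum_mem_le (n : ℕ) {I : Set ℝ} (hI : MeasurableSet I) :
    waitingLaw {w | ∑ k ∈ Finset.range (n + 1), w k ∈ I} ≤ volume I := by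
  have hind : iIndepFun (fun (k : ℕ) (w : ℕ → ℝ) => w k) waitingLaw :=
    iIndepFun_infinitePi (P := fun _ : ℕ => expMeasure 1) (X := fun _ s => s)
      fun _ => measurable_id
  have hm : ∀ k : ℕ, Measurable fun w : ℕ → ℝ => w k := fun k => measurable_pi_apply k
  have hsum : Measurable (∑ k ∈ Finset.range n, fun w : ℕ → ℝ => w k) :=
by
    rw [show (∑ k ∈ Finset.range n, fun w : ℕ → ℝ => w k) =
      fun w => ∑ k ∈ Finset.range n, w k by ext; simp]
    exact Finset.measurable_sum _ fun k _ => hm k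
  have h2 : IndepFun (∑ k ∈ Finset.range n, fun w : ℕ → ℝ => w k) (fun w => w n) waitingLaw :=
    hind.indepFun_finsetSum_of_notMem hm (by simp)
  have h3 := (indepFun_iff_map_prod_eq_prod_map_map hsum.aemeasurable (hm n).aemeasurable).1 h2
  have hn : waitingLaw.map (fun w => w n) = expMeasure 1 :=
    (measurePreserving_eval_infinitePi (fun _ : ℕ => expMeasure 1) n).map_eq
  have hA : MeasurableSet {q : ℝ × ℝ | q.1 + q.2 ∈ I} :=
    (measurable_fst.add measurable_snd) hI
  calc waitingLaw {w | ∑ k ∈ Finset.range (n + 1), w k ∈ I}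
      = waitingLaw.map (fun w => ((∑ k ∈ Finset.range n, fun w : ℕ → ℝ => w k) w, w n))
          {q : ℝ × ℝ | q.1 + q.2 ∈ I} := by
        rw [Measure.map_apply (hsum.prodMk (hm n)) hA]
        congr 1
        ext w
        simp [Finset.sum_range_succ]
    _ = ∫⁻ s, expMeasure 1 (Prod.mk s ⁻¹' {q : ℝ × ℝ | q.1 + q.2 ∈ I})
          ∂(waitingLaw.map (∑ k ∈ Finset.range n, fun w : ℕ → ℝ => w k)) := by
        rw [h3, hn, Measure.prod_apply hA]
    _ ≤ ∫⁻ s, volume I ∂(waitingLaw.map (∑ k ∈ Finset.range n, fun w : ℕ → ℝ => w k)) := by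
        refine lintegral_mono fun s => (expMeasure_one_le_volume _).trans ?_
        exact (measure_preimage_add volume s I).le
    _ = volume I := by
        have := Measure.isProbabilityMeasure_map (μ := waitingLaw) hsum.aemeasurable
        simp

/-- The event that the clock rings at a time in `I`. -/
def ringsIn (I : Set ℝ) : Set (ℕ → ℝ) := {w | ∃ n, ∑ k ∈ Finset.range (n + 1), w k ∈ I}

theorem measurableSet_ringsIn {I : Set ℝ} (hI : MeasurableSet I) : MeasurableSet (ringsIn I) := by
  have : ringsIn I = ⋃ n, (fun w : ℕ → ℝ => ∑ k ∈ Finset.range (n + 1), w k) ⁻¹' I := by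
    ext w; simp [ringsIn]
  rw [this]
  exact MeasurableSet.iUnion fun n =>
    (Finset.measurable_sum _ fun k _ => measurable_pi_apply k) hI

/-- Either one of the first `M` rings falls in the interval, or a later one does, and then the first
`M` waiting times are all at most `T`. -/
theorem waitingLaw_ringsIn_le (M : ℕ) {a b T : ℝ} (hb : b ≤ T) :
    waitingLaw (ringsIn (Set.Ico a b)) ≤
      M * ENNReal.ofReal (b - a) + expMeasure 1 (Set.Iic T) ^ M := by
  have hsub : ∀ᵐ w ∂waitingLaw, w ∈ ringsIn (Set.Ico a b) →
      w ∈ (⋃ n ∈ Finset.range M, {w : ℕ → ℝ | ∑ k ∈ Finset.range (n + 1), w k ∈ Set.Ico a b}) ∪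
        {w | ∀ k < M, w k ≤ T} := by
    filter_upwards [ae_waitingLaw_pos] with w hw
    rintro ⟨n, hn⟩
    by_cases hnM : n < M
    · exact .inl (Set.mem_iUnion₂.2 ⟨n, Finset.mem_range.2 hnM, hn⟩)
    · refine .inr fun k hk => ?_
      have : w k ≤ ∑ k ∈ Finset.range (n + 1), w k :=
        Finset.single_le_sum (fun k _ => (hw k).le) (Finset.mem_range.2 (by omega))
      linarith [hn.2]
  refine (measure_mono_ae hsub).trans ((measure_union_le _ _).trans ?_)
  rw [waitingLaw_forall_le]
  gcongr
  calc _ ≤ ∑ n ∈ Finset.range M, waitingLaw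
          {w : ℕ → ℝ | ∑ k ∈ Finset.range (n + 1), w k ∈ Set.Ico a b} :=
        measure_biUnion_finset_le _ _
    _ ≤ ∑ n ∈ Finset.range M, ENNReal.ofReal (b - a) := by
        refine Finset.sum_le_sum fun n _ => (waitingLaw_sum_mem_le n measurableSet_Ico).trans ?_
        rw [Real.volume_Ico]
    _ = M * ENNReal.ofReal (b - a) := by simp

/-- `M` is chosen first, to make the tail small, then `δ ≤ 1` in terms of `M`; hence the bound `T +
1` for the right end of the interval. -/
theorem exists_length_waitingLaw_ringsIn_le (T : ℝ) {q : ℝ≥0∞} (hq : 0 < q) :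
    ∃ δ : ℝ, 0 < δ ∧ ∀ a ≤ T, waitingLaw (ringsIn (Set.Ico a (a + δ))) ≤ q := by
  wlog hq' : q ≤ 1 generalizing q
  · obtain ⟨δ, h, h'⟩ := this (lt_min hq zero_lt_one) (min_le_right _ _)
    exact ⟨δ, h, fun a ha => (h' a ha).trans (min_le_left _ _)⟩
  have hqt : q ≠ ∞ := ne_top_of_le_ne_top ENNReal.one_ne_top hq'
  have hq2 : 0 < q / 2 := ENNReal.half_pos hq.ne'
  have hc : Tendsto (fun M : ℕ => expMeasure 1 (Set.Iic (T + 1)) ^ M) atTop (𝓝 0) :=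
    ENNReal.tendsto_pow_atTop_nhds_zero_of_lt_one (expMeasure_one_Iic_lt_one _)
  obtain ⟨M, hM⟩ := (hc.eventually (Iic_mem_nhds hq2)).exists
  have hδ : Tendsto (fun δ : ℝ => (M : ℝ≥0∞) * ENNReal.ofReal δ) (𝓝[>] 0) (𝓝 0) := by
    have h1 : Tendsto (fun δ : ℝ => ENNReal.ofReal δ) (𝓝[>] 0) (𝓝 0) := by
      have := (ENNReal.continuous_ofReal.tendsto 0).mono_left
        (nhdsWithin_le_nhds (s := Set.Ioi (0 : ℝ)))
      simpa using this
    have := ENNReal.Tendsto.const_mul (a := (M : ℝ≥0∞)) h1 (.inr (ENNReal.natCast_ne_top M))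
    simpa using this
  have h1 : ∀ᶠ δ : ℝ in 𝓝[>] 0, δ ≤ 1 :=
    nhdsWithin_le_nhds (Iic_mem_nhds zero_lt_one)
  obtain ⟨δ, ⟨hδM, hδ1⟩, hδ0⟩ :=
    (((hδ.eventually (Iic_mem_nhds hq2)).and h1).and self_mem_nhdsWithin).exists
  refine ⟨δ, hδ0, fun a ha => ?_⟩
  refine (waitingLaw_ringsIn_le M (T := T + 1) (by linarith)).trans ?_
  rw [add_sub_cancel_left, ← ENNReal.add_halves q]
  exact add_le_add hδM hM

end Clocks

/-! ### Independence over the vertices. -/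

section ClockFamily

open scoped ENNReal

variable {W : Type*}

theorem measurePreserving_waitingTimes (W : Type*) (θ : unitInterval) :
    MeasurePreserving (fun ω : Sample W => fun x k => ω.2.1 (x, k)) (law W θ)
      (Measure.infinitePi fun _ : W => waitingLaw) := by
  have h1 : MeasurePreserving (fun ω : Sample W => ω.2) (law W θ) (dynLaw W) :=
    measurePreserving_snd
  have h2 : MeasurePreserving (fun ω : (W × ℕ → ℝ) × (W × ℕ → Spin) => ω.1) (dynLaw W)
      (Measure.infinitePi fun _ : W × ℕ => expMeasure 1) := measurePreserving_fst
  have h3 : MeasurePreserving (MeasurableEquiv.curry W ℕ ℝ)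
      (Measure.infinitePi fun _ : W × ℕ => expMeasure 1)
      (Measure.infinitePi fun _ : W => waitingLaw) :=
    ⟨MeasurableEquiv.measurable _, Measure.infinitePi_map_curry fun _ _ => expMeasure 1⟩
  exact h3.comp (h2.comp h1)

theorem ae_law_of_ae_waitingLaw (θ : unitInterval) {P : (ℕ → ℝ) → Prop}
    (hP : ∀ᵐ w ∂waitingLaw, P w) (x : W) : ∀ᵐ ω ∂law W θ, P fun k => ω.2.1 (x, k) :=
  ((measurePreserving_eval_infinitePi (fun _ : W => waitingLaw) x).comp
    (measurePreserving_waitingTimes W θ)).quasiMeasurePreserving.ae hP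

theorem law_iInter_waitingTimes_mem (θ : unitInterval) {A : Set (ℕ → ℝ)} (hA : MeasurableSet A)
    (R : Finset W) :
    law W θ (⋂ v ∈ R, {ω | (fun k => ω.2.1 (v, k)) ∈ A}) = waitingLaw A ^ R.card := by
  have h := Measure.infinitePi_pi (fun _ : W => waitingLaw) (s := R) (t := fun _ => A)
    fun _ _ => hA
  rw [Finset.prod_const] at h
  rw [← h, ← (measurePreserving_waitingTimes W θ).measure_preimage
    (MeasurableSet.pi R.countable_toSet fun _ _ => hA).nullMeasurableSet]
  congr 1
  ext ω
  simp [Set.mem_pi]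

theorem law_iInter_initial_eq_false (θ : unitInterval) (R : Finset W) :
    law W θ (⋂ v ∈ R, {ω | initial ω v = false}) = ENNReal.ofReal (1 - θ) ^ R.card := by
  have h1 : MeasurePreserving (fun ω : Sample W => ω.1) (law W θ)
    (Measure.infinitePi fun _ : W => bernoulliMeasure true false θ) := measurePreserving_fst
  have h := Measure.infinitePi_pi (fun _ : W => bernoulliMeasure true false θ) (s := R)
    (t := fun _ => {false}) fun _ _ => measurableSet_singleton _
  have hf : bernoulliMeasure true false θ {false} = ENNReal.ofReal (1 - θ) := by
    rw [bernoulliMeasure_apply_of_notMem_of_mem θ (by measurability) (by simp) (by simp),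
      ENNReal.ofReal, Real.toNNReal_of_nonneg (sub_nonneg.2 θ.2.2)]
    rfl
  rw [Finset.prod_const, hf] at h
  rw [← h, ← h1.measure_preimage
    (MeasurableSet.pi R.countable_toSet fun _ _ => measurableSet_singleton _).nullMeasurableSet]
  congr 1
  ext ω
  simp [Set.mem_pi, initial]

end ClockFamily

end MajorityDynamics

namespace MajorityDynamics

/-! ### No infinite backward chain of rings. -/

section RegularClocks

variable {W : Type*}

/-- A family of clocks for which the dynamics on `G` is well defined: the rings of each clock are
positive, increasing and unbounded, and no infinite chain of rings goes back in time along the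
edges of `G`. -/
structure RegularClocks (G : SimpleGraph W) (τ : W → ℕ → ℝ) : Prop where
  pos : ∀ x n, 0 < τ x n
  strictMono : ∀ x, StrictMono (τ x)
  unbounded : ∀ x T, ∃ n, T < τ x n
  wf : WellFounded fun a b : W × ℕ => G.Adj b.1 a.1 ∧ τ a.1 a.2 < τ b.1 b.2

/-- Along an infinite backward chain the slab index `⌊t / δ⌋₊` is nonincreasing, so the chain ends
up in one slab. There its vertices form animals of bounded size, so they are finitely many; each
rings finitely often before `T`, while the chain never repeats a ring. -/
theorem wellFounded_rings [DecidableEq W] {G : SimpleGraph W} {τ : W → ℕ → ℝ}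
    (pos : ∀ x n, 0 < τ x n) (mono : ∀ x, StrictMono (τ x)) (unbounded : ∀ x T, ∃ n, T < τ x n)
    (h : ∀ T : ℕ, ∃ δ : ℝ, 0 < δ ∧ ∀ j : ℕ, j * δ ≤ T → ∀ x, ∃ N, ∀ C, IsAnimal G x C →
      (∀ v ∈ C, ∃ n, τ v n ∈ Set.Ico (j * δ) (j * δ + δ)) → C.card < N) :
    WellFounded fun a b : W × ℕ => G.Adj b.1 a.1 ∧ τ a.1 a.2 < τ b.1 b.2 := by
  rw [wellFounded_iff_isEmpty_descending_chain]
  refine ⟨fun ⟨f, hf⟩ => ?_⟩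
  set t : ℕ → ℝ := fun k => τ (f k).1 (f k).2 with ht
  have htanti : StrictAnti t := strictAnti_nat_of_succ_lt fun k => (hf k).2
  have htpos : ∀ k, 0 < t k := fun k => pos _ _
  obtain ⟨T, hT⟩ := exists_nat_gt (t 0)
  obtain ⟨δ, hδ, hδT⟩ := h T
  have hj : Antitone fun k => ⌊t k / δ⌋₊ := fun a b hab =>
    Nat.floor_mono (by gcongr; exact htanti.antitone hab)
  obtain ⟨k₀, hk₀⟩ : ∃ k₀, ∀ k, k₀ ≤ k → ⌊t k₀ / δ⌋₊ = ⌊t k / δ⌋₊ := by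
    let k₀ := Function.argmin fun k => ⌊t k / δ⌋₊
    exact ⟨k₀, fun k hk => le_antisymm (Function.argmin_le (fun k => ⌊t k / δ⌋₊) k) (hj hk)⟩
  set j := ⌊t k₀ / δ⌋₊
  have hmem : ∀ k, k₀ ≤ k → t k ∈ Set.Ico (j * δ) (j * δ + δ) := by
    intro k hk
    rw [hk₀ k hk]
    have h1 := Nat.floor_le (div_pos (htpos k) hδ).le
    have h2 := Nat.lt_floor_add_one (t k / δ)
    rw [le_div_iff₀ hδ] at h1
    rw [div_lt_iff₀ hδ] at h2
    exact ⟨h1, by linarith⟩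
  have hjT : j * δ ≤ T := (hmem k₀ le_rfl).1.trans
    ((htanti.antitone (Nat.zero_le k₀)).trans hT.le)
  obtain ⟨N, hN⟩ := hδT j hjT (f k₀).1
  let C : ℕ → Finset W := fun m => (Finset.range (m + 1)).image fun i => (f (k₀ + i)).1
  have hC : ∀ m, IsAnimal G (f k₀).1 (C m) := by
    intro m
    induction m with
    | zero => simpa [C] using IsAnimal.single
    | succ m ih =>
      have : C (m + 1) = insert (f (k₀ + (m + 1))).1 (C m) := by
        simp only [C]
        rw [Finset.range_add_one (n := m + 1), Finset.image_insert]
      rw [this]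
      refine ih.grow (u := (f (k₀ + m)).1) ?_ (hf (k₀ + m)).1
      exact Finset.mem_image_of_mem _ (by simp)
  have hCN : ∀ m, (C m).card < N := by
    intro m
    refine hN _ (hC m) fun v hv => ?_
    obtain ⟨i, -, rfl⟩ := Finset.mem_image.1 hv
    exact ⟨_, hmem (k₀ + i) (by omega)⟩
  have hfin : (Set.range fun i => (f (k₀ + i)).1).Finite := by
    by_contra hinf
    obtain ⟨s, hs, hsN⟩ := Set.Infinite.exists_subset_card_eq hinf N
    choose! g hg using fun y (hy : y ∈ s) => hs hy
    have : s ⊆ C (s.sup g) := fun y hy => Finset.mem_image.2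
      ⟨g y, Finset.mem_range.2 (Nat.lt_succ_of_le (Finset.le_sup (f := g) hy)), hg y hy⟩
    have := Finset.card_le_card this
    have := hCN (s.sup g)
    omega
  choose b hb using fun y => unbounded y T
  obtain ⟨B, hB⟩ := (hfin.image b).bddAbove
  have hlt : ∀ i, (f (k₀ + i)).2 < B + 1 := by
    intro i
    by_contra! hle
    have h1 : b (f (k₀ + i)).1 ≤ B := hB (Set.mem_image_of_mem _ (Set.mem_range_self i))
    have h2 := (mono (f (k₀ + i)).1).monotone (h1.trans (by omega : B ≤ (f (k₀ + i)).2))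
    have h3 : t (k₀ + i) ≤ t 0 := htanti.antitone (Nat.zero_le _)
    have h4 := hb (f (k₀ + i)).1
    simp only [ht] at h3 hT
    linarith
  have hinj : Function.Injective fun i => f (k₀ + i) := by
    intro a c hac
    have : t (k₀ + a) = t (k₀ + c) := by simp only [ht]; rw [show f (k₀ + a) = f (k₀ + c) from hac]
    have := htanti.injective this
    omega
  refine Set.infinite_range_of_injective hinj ((hfin.prod (Set.finite_Iio (B + 1))).subset ?_)
  rintro _ ⟨i, rfl⟩
  exact ⟨⟨i, rfl⟩, hlt i⟩

open scoped ENNReal in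
theorem ae_regularClocks [DecidableEq W] [Countable W] {G : SimpleGraph W} {D : ℕ}
    {e : W → Fin D → W} (he : ∀ x y, G.Adj x y → ∃ k, e x k = y) (hD : 0 < D)
    (θ : unitInterval) : ∀ᵐ ω ∂law W θ, RegularClocks G (ringTime ω) := by
  have hD0 : (D : ℝ≥0∞) ≠ 0 := by exact_mod_cast hD.ne'
  obtain ⟨r, hr0, hr⟩ : ∃ r : ℝ≥0∞, 0 < r ∧ 2 * (D : ℝ≥0∞) ^ 2 * r ≤ 2⁻¹ := by
    have h0 : (2 * (D : ℝ≥0∞) ^ 2) ≠ 0 := by simp [hD0]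
    have ht : (2 * (D : ℝ≥0∞) ^ 2) ≠ ∞ :=
      ENNReal.mul_ne_top (by simp) (ENNReal.pow_ne_top (ENNReal.natCast_ne_top D))
    refine ⟨(2 * (D : ℝ≥0∞) ^ 2)⁻¹ * 2⁻¹, ?_, ?_⟩
    · exact ENNReal.mul_pos (ENNReal.inv_ne_zero.2 ht) (by simp)
    · rw [← mul_assoc, ENNReal.mul_inv_cancel h0 ht, one_mul]
  have hδ : ∀ T : ℕ, ∃ δ : ℝ, 0 < δ ∧ ∀ a ≤ (T : ℝ),
      waitingLaw (ringsIn (Set.Ico a (a + δ))) ≤ r ^ 3 := fun T =>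
    exists_length_waitingLaw_ringsIn_le T (ENNReal.pow_pos hr0 3)
  choose δ hδ0 hδ using hδ
  have hpos : ∀ᵐ ω ∂law W θ, ∀ x k, 0 < ω.2.1 (x, k) :=
    ae_all_iff.2 fun x => ae_law_of_ae_waitingLaw θ ae_waitingLaw_pos x
  have hunb : ∀ᵐ ω ∂law W θ, ∀ x (T : ℕ), ∃ n, (T : ℝ) < ringTime ω x n :=
    ae_all_iff.2 fun x => ae_all_iff.2 fun T =>
      ae_law_of_ae_waitingLaw θ (ae_waitingLaw_exists_lt_sum T) x
  have hper : ∀ᵐ ω ∂law W θ, ∀ (T j : ℕ), j * δ T ≤ T → ∀ x, ∃ N, ∀ C R : Finset W,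
      IsAnimal G x C → R ⊆ C → (∀ v ∈ R, ω ∈ {ω : Sample W | (fun k => ω.2.1 (v, k)) ∈
        ringsIn (Set.Ico (j * δ T) (j * δ T + δ T))}) → C.card ≤ 3 * R.card → C.card < N := by
    refine ae_all_iff.2 fun T => ae_all_iff.2 fun j => eventually_imp_distrib_left.2
      fun hj => ae_all_iff.2 fun x => ?_
    refine ae_exists_animal_card_lt he hD hr (fun R => ?_) x
    rw [law_iInter_waitingTimes_mem θ (measurableSet_ringsIn measurableSet_Ico)]
    exact pow_le_pow_left₀ zero_le (hδ T _ hj) _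
  filter_upwards [hpos, hunb, hper] with ω h1 h2 h3
  have hm : ∀ x, StrictMono (ringTime ω x) := fun x => strictMono_nat_of_lt_succ fun n => by
    rw [ringTime, ringTime, Finset.sum_range_succ _ (n + 1)]
    linarith [h1 x (n + 1)]
  have hp : ∀ x n, 0 < ringTime ω x n := fun x n =>
    Finset.sum_pos (fun k _ => h1 x k) (by simp)
  have hu : ∀ x T, ∃ n, T < ringTime ω x n := fun x T => by
    obtain ⟨T', hT'⟩ := exists_nat_gt T
    obtain ⟨n, hn⟩ := h2 x T'
    exact ⟨n, hT'.trans hn⟩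
  refine ⟨hp, hm, hu, wellFounded_rings hp hm hu fun T => ⟨δ T, hδ0 T, fun j hj x => ?_⟩⟩
  obtain ⟨N, hN⟩ := h3 T j hj x
  -- Here every vertex of the animal is marked, so `R = C`.
  exact ⟨N, fun C hC hv => hN C C hC subset_rfl hv (by omega)⟩

end RegularClocks

/-! ### Construction of the dynamics. -/

section Existence

variable {W : Type*} {G : SimpleGraph W}

theorem neighborCount_congr {η η' : W → Spin} {x : W} (h : ∀ y, G.Adj x y → η y = η' y)
    (s : Spin) : neighborCount G η x s = neighborCount G η' x s := by
  unfold neighborCount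
  congr 1
  ext y
  constructor <;> rintro ⟨h1, h2⟩
  · exact ⟨h1, h y h1 ▸ h2⟩
  · exact ⟨h1, (h y h1).trans h2⟩

theorem majority_congr {η η' : W → Spin} {x : W} (h : ∀ y, G.Adj x y → η y = η' y) (c : Spin) :
    majority G η x c = majority G η' x c := by
  unfold majority
  rw [neighborCount_congr h, neighborCount_congr h]

/-- The spin after each ring is defined by well-founded recursion over earlier rings of neighbours.
Only strictly earlier rings are used, so simultaneous rings do no harm. -/
theorem exists_follows {ω : Sample W} (hω : RegularClocks G (ringTime ω))
    (hfin : ∀ x, {y | G.Adj x y}.Finite) : ∃ σ, Follows G ω σ := by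
  classical
  set τ := ringTime ω with hτ
  -- the number of rings up to time `t`, and strictly before time `t`
  let upTo : W → ℝ → ℕ := fun y t => Nat.find (hω.unbounded y t)
  have hge : ∀ y t, ∃ n, t ≤ τ y n := fun y t => (hω.unbounded y t).imp fun _ => le_of_lt
  let before : W → ℝ → ℕ := fun y t => Nat.find (hge y t)
  have hbefore : ∀ y t m, before y t = m + 1 → τ y m < t := fun y t m h =>
    not_le.1 (Nat.find_min (hge y t) (show m < before y t by omega))
  obtain ⟨S, hS⟩ : ∃ S : W × ℕ → Spin, ∀ a, S a = majority G
      (fun y => match before y (τ a.1 a.2) with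
        | 0 => initial ω y
        | m + 1 => S (y, m)) a.1 (coin ω a.1 a.2) := by
    -- The default `true` is never used for a neighbour `y`, by `hbefore`; non-neighbours do not
    -- affect `majority`.
    let F : (a : W × ℕ) → ((b : W × ℕ) → (G.Adj a.1 b.1 ∧ τ b.1 b.2 < τ a.1 a.2) → Spin) → Spin :=
      fun a S => majority G (fun y => match before y (τ a.1 a.2) with
        | 0 => initial ω y
        | m + 1 => if h : G.Adj a.1 y ∧ τ y m < τ a.1 a.2 then S (y, m) h else true)
        a.1 (coin ω a.1 a.2)
    refine ⟨hω.wf.fix F, fun a => ?_⟩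
    rw [hω.wf.fix_eq]
    refine majority_congr (fun y hy => ?_) _
    rcases h : before y (τ a.1 a.2) with _ | m
    · rfl
    · simp only
      rw [dif_pos ⟨hy, hbefore _ _ _ h⟩]
  let state : W → ℕ → Spin := fun y k => match k with
    | 0 => initial ω y
    | m + 1 => S (y, m)
  refine ⟨fun t y => state y (upTo y t), ?_, ?_, ?_⟩
  · intro x
    have : upTo x (0 : ℝ≥0) = 0 := (Nat.find_eq_zero _).2 (by simpa using hω.pos x 0)
    simp only [this, state]
  · intro x s t hst hno
    have : upTo x t = upTo x s := by
      refine le_antisymm ?_ ?_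
      · refine Nat.find_min' _ ?_
        have h1 : (s : ℝ) < τ x (upTo x s) := Nat.find_spec (hω.unbounded x s)
        by_contra! h2
        exact hno _ ⟨h1, h2⟩
      · exact Nat.find_mono fun n hn => lt_of_le_of_lt (NNReal.coe_le_coe.2 hst) hn
    simp only [this]
  · intro x n t ht
    have hxt : upTo x t = n + 1 := by
      refine (Nat.find_eq_iff _).2 ⟨?_, fun m hm => ?_⟩
      · rw [← ht]; exact hω.strictMono x (Nat.lt_succ_self n)
      · rw [← ht, not_lt]; exact (hω.strictMono x).monotone (by omega)
    -- Just before `t`, all rings of the finitely many neighbours that precede `t` have already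
    -- occurred.
    have hev : ∀ᶠ s : ℝ≥0 in 𝓝[<] t, ∀ y ∈ {y | G.Adj x y}, upTo y s = before y t := by
      rw [eventually_all_finite (hfin x)]
      intro y _
      have hlast : ∀ᶠ s : ℝ≥0 in 𝓝[<] t, ∀ m < before y t, τ y m ≤ s := by
        have h1 : ∀ m ∈ Finset.range (before y t), ∀ᶠ s : ℝ≥0 in 𝓝[<] t, τ y m ≤ s := by
          intro m hm
          have h2 : τ y m < t := not_le.1 (Nat.find_min (hge y t) (Finset.mem_range.1 hm))
          have h3 : Tendsto (fun s : ℝ≥0 => (s : ℝ)) (𝓝[<] t) (𝓝 (t : ℝ)) :=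
            (NNReal.continuous_coe.tendsto t).mono_left nhdsWithin_le_nhds
          exact h3.eventually (Ici_mem_nhds h2)
        filter_upwards [(Filter.eventually_all_finset _).2 h1] with s hs m hm
        exact hs m (Finset.mem_range.2 hm)
      filter_upwards [hlast, self_mem_nhdsWithin] with s hs hst
      refine (Nat.find_eq_iff _).2 ⟨?_, fun m hm => not_lt.2 (hs m hm)⟩
      exact lt_of_lt_of_le (NNReal.coe_lt_coe.2 hst) (Nat.find_spec (hge y t))
    filter_upwards [hev] with s hs
    simp only [hxt]
    change S (x, n) = _
    rw [hS]
    refine majority_congr (fun y hy => ?_) _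
    simp only [state]
    rw [hs y hy, show τ x n = t from ht]

end Existence

end MajorityDynamics

namespace MajorityDynamics

/-! ### Stability of live vertices and erosion of dead clusters. -/

section Fixation

variable {W : Type*} {G : SimpleGraph W}

theorem majority_eq_true_of_subset {η : W → Spin} {x : W} {A : Set W}
    (hdeg : 5 ≤ {y | G.Adj x y}.ncard) (hA : A.Finite) (hA2 : A.ncard ≤ 2)
    (h : ∀ y, G.Adj x y → η y = false → y ∈ A) (c : Spin) : majority G η x c = true := by
  have hfin : {y | G.Adj x y}.Finite := Set.finite_of_ncard_pos (by omega)
  have h1 : neighborCount G η x false ≤ 2 :=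
    (Set.ncard_le_ncard (fun y hy => h y hy.1 hy.2) hA).trans hA2
  have h2 : {y | G.Adj x y} ⊆ {y | G.Adj x y ∧ η y = true} ∪ {y | G.Adj x y ∧ η y = false} := by
    intro y hy
    rcases h : η y
    · exact .inr ⟨hy, h⟩
    · exact .inl ⟨hy, h⟩
  have h3 := (Set.ncard_le_ncard h2
    ((hfin.subset fun y hy => hy.1).union (hfin.subset fun y hy => hy.1))).trans
    (Set.ncard_union_le _ _)
  rw [majority, if_pos]
  unfold neighborCount at h1 ⊢
  omega

variable {ω : Sample W} {σ : ℝ≥0 → W → Spin}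

theorem Follows.eq_or_exists_ring (hσ : Follows G ω σ) (hω : RegularClocks G (ringTime ω)) {x : W}
    {s t : ℝ≥0} (hst : s ≤ t) : σ t x = σ s x ∨
      ∃ n, ∃ r : ℝ≥0, ringTime ω x n = r ∧ s < r ∧ r ≤ t ∧ σ t x = σ r x := by
  classical
  let k := Nat.find (hω.unbounded x t)
  have hk : (t : ℝ) < ringTime ω x k := Nat.find_spec (hω.unbounded x t)
  have hlt : ∀ m, ringTime ω x m ≤ t → m < k := fun m hm => by
    by_contra! hle
    exact absurd ((hω.strictMono x).monotone hle) (not_le.2 (hm.trans_lt hk))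
  by_cases h : ∀ n, ringTime ω x n ∉ Set.Ioc (s : ℝ) t
  · exact .inl (hσ.stay x s t hst h)
  push Not at h
  obtain ⟨n, hn⟩ := h
  have hk1 : ringTime ω x (k - 1) ≤ t := by
    have := hlt n hn.2
    exact not_lt.1 (Nat.find_min (hω.unbounded x t) (show k - 1 < k by omega))
  have hnk : n ≤ k - 1 := by have := hlt n hn.2; omega
  refine .inr ⟨k - 1, ⟨ringTime ω x (k - 1), (hω.pos _ _).le⟩, rfl, ?_, hk1, ?_⟩
  · exact hn.1.trans_le ((hω.strictMono x).monotone hnk)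
  · refine hσ.stay x _ t hk1 fun m hm => ?_
    have h1 := (hω.strictMono x).lt_iff_lt.1 hm.1
    have h2 := hlt m hm.2
    omega

theorem Follows.eq_true_of_rings (hσ : Follows G ω σ) (hω : RegularClocks G (ringTime ω)) {x : W}
    {s : ℝ≥0} (hs : σ s x = true)
    (h : ∀ n (r : ℝ≥0), ringTime ω x n = r → s < r → σ r x = true) {t : ℝ≥0} (hst : s ≤ t) :
    σ t x = true := by
  rcases hσ.eq_or_exists_ring hω hst with h1 | ⟨n, r, hr, hsr, -, h1⟩
  · rw [h1, hs]
  · rw [h1, h n r hr hsr]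

/-- A set of initially positive vertices, each of which has at most two neighbours outside the
set, remains positive. -/
theorem Follows.eq_true_of_stable (hσ : Follows G ω σ) (hω : RegularClocks G (ringTime ω))
    (hdeg : ∀ x, 5 ≤ {y | G.Adj x y}.ncard) {A : Set W} (hA : ∀ x ∈ A, initial ω x = true)
    (hA2 : ∀ x ∈ A, {y | G.Adj x y ∧ y ∉ A}.ncard ≤ 2) {x : W} (hx : x ∈ A) (t : ℝ≥0) :
    σ t x = true := by
  -- Induction along backward chains: just before the ring, a neighbour in `A` has its initial spin
  -- or the spin given by an earlier ring of its own.
  have key : ∀ a : W × ℕ, a.1 ∈ A → ∀ r : ℝ≥0, ringTime ω a.1 a.2 = r → σ r a.1 = true := by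
    intro a
    induction a using hω.wf.induction with
    | h a ih =>
      intro ha r hr
      have hr0 : 0 < r := by
        rw [← NNReal.coe_pos, ← hr]; exact hω.pos _ _
      have hne : (𝓝[<] r).NeBot := nhdsLT_neBot_of_exists_lt ⟨0, hr0⟩
      obtain ⟨s, hs, hsr⟩ := ((hσ.update a.1 a.2 r hr).and self_mem_nhdsWithin).exists
      rw [hs]
      have hfin : {y | G.Adj a.1 y}.Finite := Set.finite_of_ncard_pos (by have := hdeg a.1; omega)
      refine majority_eq_true_of_subset (hdeg _) (hfin.subset fun y hy => hy.1) (hA2 _ ha)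
        (fun y hy hys => ⟨hy, fun hyA => ?_⟩) _
      rcases hσ.eq_or_exists_ring hω (zero_le (a := s)) (x := y) with h1 | ⟨n, r', hr', -, hrs, h1⟩
      · rw [h1, hσ.start, hA y hyA] at hys
        cases hys
      · rw [h1, ih (y, n) ⟨hy, ?_⟩ hyA r' hr'] at hys
        · cases hys
        · change ringTime ω y n < ringTime ω a.1 a.2
          rw [hr, hr']
          exact NNReal.coe_lt_coe.2 (hrs.trans_lt hsr)
  refine hσ.eq_true_of_rings hω (s := 0) ?_ (fun n r hr _ => key (x, n) hx r hr) zero_le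
  rw [hσ.start, hA x hx]

/-- A vertex all of whose neighbours but two are eventually positive is eventually positive. -/
theorem Follows.eventually_eq_true (hσ : Follows G ω σ) (hω : RegularClocks G (ringTime ω))
    (hdeg : ∀ x, 5 ≤ {y | G.Adj x y}.ncard) {x : W} {A : Set W} (hA : A.Finite)
    (hA2 : A.ncard ≤ 2)
    (h : ∀ y, G.Adj x y → y ∉ A → ∀ᶠ t in atTop, σ t y = true) :
    ∀ᶠ t in atTop, σ t x = true := by
  have hfin : {y | G.Adj x y}.Finite := Set.finite_of_ncard_pos (by have := hdeg x; omega)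
  have hfin' : {y | G.Adj x y ∧ y ∉ A}.Finite := hfin.subset fun y hy => hy.1
  obtain ⟨T, hT⟩ := eventually_atTop.1 ((eventually_all_finite hfin').2
    fun y hy => h y hy.1 hy.2)
  have key : ∀ n (r : ℝ≥0), ringTime ω x n = r → T < r → σ r x = true := by
    intro n r hr hTr
    have hne : (𝓝[<] r).NeBot := nhdsLT_neBot_of_exists_lt ⟨T, hTr⟩
    obtain ⟨s, hs, hsr⟩ := ((hσ.update x n r hr).and (Ioo_mem_nhdsLT hTr)).exists
    rw [hs]
    refine majority_eq_true_of_subset (hdeg _) hA hA2 (fun y hy hys => ?_) _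
    by_contra hyA
    rw [hT s hsr.1.le y ⟨hy, hyA⟩] at hys
    cases hys
  obtain ⟨n, hn⟩ := hω.unbounded x T
  have hr : ringTime ω x n = (⟨ringTime ω x n, (hω.pos _ _).le⟩ : ℝ≥0) := rfl
  refine eventually_atTop.2 ⟨⟨ringTime ω x n, (hω.pos _ _).le⟩, fun t ht => ?_⟩
  refine hσ.eq_true_of_rings hω (key n _ hr hn) (fun m r' hr' hlt => ?_) ht
  exact key m r' hr' (lt_trans hn hlt)

/-- If every edge joins a vertex to one of its two parents, of smaller height, a finite set of
vertices all of whose neighbours outside the set are eventually positive is eventually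
positive. -/
theorem Follows.eventually_eq_true_of_finite (hσ : Follows G ω σ)
    (hω : RegularClocks G (ringTime ω)) (hdeg : ∀ x, 5 ≤ {y | G.Adj x y}.ncard)
    {p : Bool → W → W} {h : W → ℤ}
    (hp : ∀ x y, G.Adj x y → (∃ k, p k x = y) ∨ h x < h y) (B : Finset W)
    (hB : ∀ x ∈ B, ∀ y, G.Adj x y → y ∉ B → ∀ᶠ t in atTop, σ t y = true) :
    ∀ x ∈ B, ∀ᶠ t in atTop, σ t x = true := by
  classical
  induction hn : B.card generalizing B with
  | zero => simp [Finset.card_eq_zero.1 hn]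
  | succ n ih =>
    -- At a vertex of maximal height, any neighbour inside `B` is one of its two parents.
    obtain ⟨x, hx, hmax⟩ := B.exists_max_image h (Finset.card_pos.1 (by omega))
    have hxt : ∀ᶠ t in atTop, σ t x = true := by
      refine hσ.eventually_eq_true hω hdeg (A := {p true x, p false x}) (Set.toFinite _)
        (Set.ncard_insert_le _ _ |>.trans (by simp)) fun y hy hyA => hB x hx y hy fun hyB => ?_
      rcases hp x y hy with ⟨k, rfl⟩ | hlt
      · cases k <;> simp at hyA
      · exact absurd (hmax y hyB) (not_le.2 hlt)
    intro z hz
    by_cases hzx : z = x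
    · rwa [hzx]
    refine ih (B.erase x) (fun u hu y hy hyB => ?_) (by rw [Finset.card_erase_of_mem hx]; omega) z
      (Finset.mem_erase.2 ⟨hzx, hz⟩)
    by_cases hyx : y = x
    · rwa [hyx]
    · exact hB u (Finset.mem_of_mem_erase hu) y hy fun h => hyB (Finset.mem_erase.2 ⟨hyx, h⟩)

theorem ncard_dead_le_two {bad : Set W} {x : W} (hdeg : 5 ≤ {y | G.Adj x y}.ncard)
    (hx : ¬ Dead G bad x) : {y | G.Adj x y ∧ Dead G bad y}.ncard ≤ 2 := by
  have hfin : {y | G.Adj x y ∧ Dead G bad y}.Finite :=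
    (Set.finite_of_ncard_pos (by omega : 0 < {y | G.Adj x y}.ncard)).subset fun y hy => hy.1
  by_contra! h
  rw [Set.ncard_eq_toFinset_card _ hfin] at h
  refine hx (.of_three hfin.toFinset h (fun y hy => ?_) fun y hy => ?_)
  · exact (hfin.mem_toFinset.1 hy).1
  · exact (hfin.mem_toFinset.1 hy).2

theorem Follows.eventually_eq_true_of_animal_bound [DecidableEq W] (hσ : Follows G ω σ)
    (hω : RegularClocks G (ringTime ω)) (hdeg : ∀ x, 5 ≤ {y | G.Adj x y}.ncard)
    {p : Bool → W → W} {h : W → ℤ}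
    (hp : ∀ x y, G.Adj x y → (∃ k, p k x = y) ∨ h x < h y) {x : W} {N : ℕ}
    (hN : ∀ C, IsAnimal G x C → (∀ y ∈ C, Dead G {y | initial ω y = false} y) → C.card < N) :
    ∀ᶠ t in atTop, σ t x = true := by
  set bad := {y | initial ω y = false} with hbad
  have hlive : ∀ y, ¬ Dead G bad y → ∀ t, σ t y = true := by
    intro y hy t
    refine hσ.eq_true_of_stable hω hdeg (A := {y | ¬ Dead G bad y}) (fun z hz => ?_)
      (fun z hz => ?_) hy t
    · by_contra hz'
      exact hz (.of_bad (by simpa [hbad] using hz'))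
    · simpa using ncard_dead_le_two (hdeg z) hz
  by_cases hx : Dead G bad x
  swap
  · exact Eventually.of_forall (hlive x hx)
  -- A largest dead animal is the whole dead cluster of `x`: a dead neighbour outside it could be
  -- added.
  obtain ⟨C, ⟨hC, hCd⟩, hmax⟩ : ∃ C, (IsAnimal G x C ∧ ∀ y ∈ C, Dead G bad y) ∧
      ∀ C', IsAnimal G x C' → (∀ y ∈ C', Dead G bad y) → C'.card ≤ C.card := by
    have hne : ∃ n, ∃ C, (IsAnimal G x C ∧ ∀ y ∈ C, Dead G bad y) ∧ C.card = n :=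
      ⟨_, {x}, ⟨.single, by simpa using hx⟩, rfl⟩
    have hb : ∀ n, (∃ C, (IsAnimal G x C ∧ ∀ y ∈ C, Dead G bad y) ∧ C.card = n) → n ≤ N := by
      rintro n ⟨C, hC, rfl⟩
      exact (hN C hC.1 hC.2).le
    classical
    obtain ⟨n, hn⟩ := hne
    obtain ⟨C, hC, hCn⟩ := Nat.findGreatest_spec (P := fun n => ∃ C,
      (IsAnimal G x C ∧ ∀ y ∈ C, Dead G bad y) ∧ C.card = n) (hb n hn) hn
    refine ⟨C, hC, fun C' h1 h2 => ?_⟩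
    rw [hCn]
    exact Nat.le_findGreatest (hN C' h1 h2).le ⟨C', ⟨h1, h2⟩, rfl⟩
  refine hσ.eventually_eq_true_of_finite hω hdeg hp C (fun u hu y hy hyC => ?_) x hC.root_mem
  refine Eventually.of_forall (hlive y fun hyd => ?_)
  have := hmax (insert y C) (hC.grow hu hy) (by simpa using ⟨hyd, hCd⟩)
  rw [Finset.card_insert_of_notMem hyC] at this
  omega

end Fixation

end MajorityDynamics

namespace MajorityDynamics

/-! ### Parents, heights and degrees in the stack. -/

section Stack

variable {V : Type*} {T : SimpleGraph V}

/-- Root the tree: `d` is the distance to the root, and the parent is the penultimate vertex of the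
path from the root. -/
theorem exists_parent (hT : T.IsTree) : ∃ (f : V → V) (d : V → ℤ), ∀ v w, T.Adj v w →
    (f v = w ∧ d w < d v) ∨ (f w = v ∧ d v < d w) := by
  obtain ⟨r⟩ := hT.connected.nonempty
  choose q hq hqd using fun v => (hT.connected r v).exists_path_of_dist
  have key : ∀ v w, T.Adj v w → T.dist r v = T.dist r w + 1 → (q v).penultimate = w := by
    intro v w h hd
    refine (hT.isAcyclic.eq_penultimate_of_adj_end (hq v) h ?_).symm
    refine hT.isAcyclic.mem_support_of_ne_mem_support_of_adj_of_isPath (hq v) (hq w) h fun hv => ?_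
    have := congrArg SimpleGraph.Walk.length (hT.isAcyclic.path_concat (hq v) (hq w) h hv)
    rw [SimpleGraph.Walk.length_concat, hqd, hqd] at this
    omega
  refine ⟨fun v => (q v).penultimate, fun v => T.dist r v, fun v w h => ?_⟩
  rcases hT.dist_eq_dist_add_one_of_adj r h with hd | hd
  · exact .inl ⟨key v w h hd, by simp only; omega⟩
  · exact .inr ⟨key w v h.symm hd, by simp only; omega⟩

theorem exists_stack_parents (hT : T.IsTree) : ∃ (p : Bool → V × ℤ → V × ℤ) (h : V × ℤ → ℤ),
    ∀ x y, (stack T).Adj x y → (∃ k, p k x = y ∧ h y < h x) ∨ (∃ k, p k y = x ∧ h x < h y) := by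
  obtain ⟨f, d, hf⟩ := exists_parent hT
  refine ⟨fun k x => if k then (f x.1, x.2) else (x.1, x.2 - 1), fun x => d x.1 + x.2, ?_⟩
  rintro ⟨u, i⟩ ⟨v, j⟩ (⟨h1, h2⟩ | ⟨h1, h2⟩)
  · obtain rfl : i = j := h1
    rcases hf u v h2 with ⟨h, hd⟩ | ⟨h, hd⟩
    · exact .inl ⟨true, by simp [h], by simpa using hd⟩
    · exact .inr ⟨true, by simp [h], by simpa using hd⟩
  · obtain rfl : u = v := h1
    rcases h2 with h2 | h2
    · obtain rfl : j = i + 1 := h2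
      exact .inr ⟨false, by simp, by simp⟩
    · obtain rfl : j = i - 1 := h2
      exact .inl ⟨false, by simp, by simp⟩

theorem ncard_stack_adj [T.LocallyFinite] {K : ℕ} (hK : T.IsRegularOfDegree K) (x : V × ℤ) :
    {y | (stack T).Adj x y}.ncard = K + 2 := by
  obtain ⟨u, i⟩ := x
  have h1 : {y | (stack T).Adj (u, i) y} =
      (fun v => (v, i)) '' T.neighborSet u ∪ {(u, i + 1), (u, i - 1)} := by
    ext ⟨v, j⟩
    simp only [stack, Set.mem_ofPred_eq, Set.mem_union, Set.mem_image, SimpleGraph.mem_neighborSet,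
      Prod.mk.injEq, Set.mem_insert_iff, Set.mem_singleton_iff]
    constructor
    · rintro (⟨rfl, h⟩ | ⟨rfl, h | h⟩)
      · exact .inl ⟨v, h, rfl, rfl⟩
      · exact .inr (.inl ⟨rfl, h⟩)
      · exact .inr (.inr ⟨rfl, h⟩)
    · rintro (⟨v, h, rfl, rfl⟩ | ⟨rfl, h⟩ | ⟨rfl, h⟩)
      · exact .inl ⟨rfl, h⟩
      · exact .inr ⟨rfl, .inl h⟩
      · exact .inr ⟨rfl, .inr h⟩
  have h2 : (T.neighborSet u).ncard = K := by
    rw [← hK u, ← SimpleGraph.card_neighborSet_eq_degree, Set.ncard_eq_toFinset_card',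
      Set.toFinset_card]
  rw [h1, Set.ncard_union_eq, Set.ncard_image_of_injective _ (Prod.mk_left_injective i), h2,
    Set.ncard_pair]
  · simp only [ne_eq, Prod.mk.injEq, not_and]; omega
  · rw [Set.disjoint_left]
    rintro _ ⟨v, -, rfl⟩ h
    simp only [Set.mem_insert_iff, Set.mem_singleton_iff, Prod.mk.injEq] at h
    omega

theorem exists_labels {W : Type*} {G : SimpleGraph W} {D : ℕ} (hD : 0 < D)
    (hdeg : ∀ x, {y | G.Adj x y}.ncard = D) :
    ∃ e : W → Fin D → W, ∀ x y, G.Adj x y → ∃ k, e x k = y := by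
  have hfin : ∀ x, {y | G.Adj x y}.Finite := fun x =>
    Set.finite_of_ncard_pos (by rw [hdeg]; exact hD)
  have hcard : ∀ x, (hfin x).toFinset.card = D := fun x => by
    rw [← Set.ncard_eq_toFinset_card _ (hfin x), hdeg]
  refine ⟨fun x k => ((Finset.equivFinOfCardEq (hcard x)).symm k).1, fun x y hxy => ?_⟩
  exact ⟨Finset.equivFinOfCardEq (hcard x) ⟨y, (hfin x).mem_toFinset.2 hxy⟩, by simp⟩

theorem countable_of_isTree [T.LocallyFinite] {K : ℕ} (hK0 : 0 < K) (hT : T.IsTree)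
    (hK : T.IsRegularOfDegree K) : Countable V := by
  classical
  obtain ⟨e, he⟩ := exists_labels (G := T) hK0 fun u => by
    change (T.neighborSet u).ncard = K
    rw [← hK u, ← SimpleGraph.card_neighborSet_eq_degree, Set.ncard_eq_toFinset_card',
      Set.toFinset_card]
  exact countable_of_labels hT.connected he

end Stack

/-! ### Assembly. -/

section Consensus

variable {W : Type*} [DecidableEq W] [Countable W] {G : SimpleGraph W} {D : ℕ}
  {e : W → Fin D → W}

theorem exists_isProcess (he : ∀ x y, G.Adj x y → ∃ k, e x k = y) (hD : 0 < D)
    (hfin : ∀ x, {y | G.Adj x y}.Finite) (θ : unitInterval) : ∃ σ, IsProcess G θ σ := by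
  classical
  refine ⟨fun ω => if h : ∃ σ, Follows G ω σ then h.choose else fun _ _ => true, ?_⟩
  filter_upwards [ae_regularClocks he hD θ] with ω hω
  have h := exists_follows hω hfin
  rw [dif_pos h]
  exact h.choose_spec

open scoped ENNReal in
theorem IsProcess.fixatesToConsensus (he : ∀ x y, G.Adj x y → ∃ k, e x k = y) (hD : 0 < D)
    (hdeg : ∀ x, 5 ≤ {y | G.Adj x y}.ncard) {p : Bool → W → W} {h : W → ℤ}
    (hp : ∀ x y, G.Adj x y → (∃ k, p k x = y ∧ h y < h x) ∨ (∃ k, p k y = x ∧ h x < h y))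
    {r : ℝ≥0∞} (hr : 2 * (D : ℝ≥0∞) ^ 2 * r ≤ 2⁻¹) {θ : unitInterval}
    (hθ : ENNReal.ofReal (1 - θ) ≤ r ^ 3) {σ : Sample W → ℝ≥0 → W → Spin}
    (hσ : IsProcess G θ σ) : FixatesToConsensus θ σ := by
  intro x
  have hE : ∀ R : Finset W, law W θ (⋂ v ∈ R, {ω | initial ω v = false}) ≤ (r ^ 3) ^ R.card :=
    fun R => (law_iInter_initial_eq_false θ R).trans_le (pow_le_pow_left₀ zero_le hθ _)
  filter_upwards [hσ, ae_regularClocks he hD θ, ae_exists_animal_card_lt he hD hr hE x]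
    with ω hσω hω ⟨N, hN⟩
  refine eventually_atTop.1 (hσω.eventually_eq_true_of_animal_bound hω hdeg (p := p) (h := h)
    (N := N) (fun y z hyz => ?_) fun C hC hCd => ?_)
  · rcases hp y z hyz with ⟨k, hk, -⟩ | ⟨-, -, hlt⟩
    · exact .inl ⟨k, hk⟩
    · exact .inr hlt
  -- A dead animal may itself contain few negative vertices, so the Peierls bound is applied to a
  -- spanned animal `F` containing it.
  · obtain ⟨F, hCF, hF, hFs⟩ := hC.exists_spanned_superset hCd
    obtain ⟨R, hRF, hR, hcard⟩ := hFs.exists_bad_subset (p := p) fun y z hyz => by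
      rcases hp y z hyz with ⟨k, hk, -⟩ | ⟨k, hk, -⟩
      · exact ⟨k, .inl hk⟩
      · exact ⟨k, .inr hk⟩
    exact (Finset.card_le_card hCF).trans_lt (hN F R hF hRF hR hcard)

end Consensus

end MajorityDynamics

open MajorityDynamics
theorem theorem1 (K : ℕ) (hK : 3 ≤ K) :
    ∃ θs : ℝ, θs < 1 ∧
      ∀ (V : Type*) (T : SimpleGraph V) [T.LocallyFinite], T.IsTree → T.IsRegularOfDegree K →
        ∀ θ : unitInterval, θs < (θ : ℝ) →
          (∃ σ, IsProcess (stack T) θ σ) ∧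
            ∀ σ, IsProcess (stack T) θ σ → FixatesToConsensus θ σ := by
  classical
  -- With degree `D = K + 2` this solves `2 * D ^ 2 * r = 1 / 2`, the ratio of the Peierls series;
  -- the threshold is `1 - r ^ 3` because only a third of the vertices are known to be negative.
  set r : ℝ := (2 * ((K + 2 : ℕ) : ℝ) ^ 2)⁻¹ * 2⁻¹ with hr
  have hr0 : 0 < r := by positivity
  refine ⟨1 - r ^ 3, by linarith [pow_pos hr0 3], fun V T _ hT hreg θ hθ => ?_⟩
  have hdeg := ncard_stack_adj hreg
  obtain ⟨e, he⟩ := exists_labels (by omega) hdeg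
  obtain ⟨p, h, hp⟩ := exists_stack_parents hT
  have := countable_of_isTree (by omega) hT hreg
  have hrD : 2 * ((K + 2 : ℕ) : ENNReal) ^ 2 * ENNReal.ofReal r ≤ 2⁻¹ := by
    have h1 : 2 * ((K + 2 : ℕ) : ℝ) ^ 2 * r = 2⁻¹ := by
      rw [hr, ← mul_assoc, mul_inv_cancel₀ (by positivity), one_mul]
    have h2 := congrArg ENNReal.ofReal h1
    rw [ENNReal.ofReal_mul (by positivity), ENNReal.ofReal_mul (by positivity),
      ENNReal.ofReal_pow (by positivity), ENNReal.ofReal_natCast,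
      ENNReal.ofReal_inv_of_pos (by positivity), ENNReal.ofReal_ofNat] at h2
    exact h2.le
  refine ⟨exists_isProcess he (by omega) (fun x => Set.finite_of_ncard_pos (by rw [hdeg]; omega)) θ,
    fun σ hσ => hσ.fixatesToConsensus he (by omega) (fun x => by rw [hdeg]; omega) hp hrD ?_⟩
  rw [← ENNReal.ofReal_pow hr0.le]
  exact ENNReal.ofReal_le_ofReal (by linarith)
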